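/- Let $K$ be an infinite field and let $A$ be a finite-dimensional unital associative $K$-algebra which is basic pointed, i.e. every simple $A$-module is one-dimensional over $K$ (so that $A/J(A)$ is a finite product of copies of $K$). Definitions. For a finite poset $P$ and a function $\lambda$ assigning to each chain $x\le y\le z$ in $P$ a scalar $\lambda(x,y,z)\in K^*=K\setminus\{0\}$, let $I_\lambda(P,K)$ be the incidence algebra $I(P,K)$ as a vector space, with basis $(f_{xy})_{x\le y}$, equipped with the bilinear multiplication $f_{xy}f_{yz}=\lambda(x,y,z)f_{xz}$ and $f_{xy}f_{tz}=0$ for $y\ne t$; it is called a deformation of the incidence algebra $I(P,K)$. A module is local if it has a largest proper submodule, distributive if its lattice of submodules is distributive, and semidistributive if it is a direct sum of distributive submodules. The algebra $A$ is left (right) locally hereditary if every local submodule of an indecomposable projective left (right) $A$-module is projective, and left (right) semidistributive if it is semidistributive as a left (right) module over itself. Theorem. The following conditions are equivalent. 1. $A$ is isomorphic, as a $K$-algebra, to a deformation $I_\lambda(P,K)$ of the incidence algebra of some finite poset $P$. 2. $A$ is left locally hereditary and left semidistributive; equivalently, $A$ is right locally hereditary and right semidistributive. 3. $A$ has only finitely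 many two-sided ideals, and $A$ is left locally hereditary or right locally hereditary. 4. For all indecomposable projective left $A$-modules $P,Q,R$: $\dim_K\operatorname{Hom}_A(P,Q)\le 1$, and if $\operatorname{Hom}_A(P,Q)\neq 0$ and $\operatorname{Hom}_A(Q,R)\ne 0$, then the composition map $\operatorname{Hom}_A(P,Q)\times\operatorname{Hom}_A(Q,R)\to\operatorname{Hom}_A(P,R)$ is not the zero map. -/

import Mathlib

universe u v

/-! ### Modules -/

/-- A nonzero module is indecomposable if it is not a direct sum of two nonzero submodules. -/
def IsIndecomposableModule (R : Type u) (M : Type v) [Ring R] [AddCommGroup M] [Module R M] :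
    Prop :=
  Nontrivial M ∧ ∀ X Y : Submodule R M, IsCompl X Y → X = ⊥ ∨ Y = ⊥

/-- A module is local if it has a largest proper submodule. -/
def IsLocalModule (R : Type u) (M : Type v) [Ring R] [AddCommGroup M] [Module R M] : Prop :=
  ∃ N : Submodule R M, N ≠ ⊤ ∧ ∀ L : Submodule R M, L ≠ ⊤ → L ≤ N

/-- A module is distributive if its lattice of submodules is distributive. -/
def IsDistributiveModule (R : Type u) (M : Type v) [Ring R] [AddCommGroup M] [Module R M] :
    Prop :=
  ∀ X Y Z : Submodule R M, X ⊓ (Y ⊔ Z) = (X ⊓ Y) ⊔ (X ⊓ Z)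

/-- A module is semidistributive if it is the (internal) direct sum of a family of distributive
submodules. -/
def IsSemidistributiveModule (R : Type u) (M : Type v) [Ring R] [AddCommGroup M] [Module R M] :
    Prop :=
  ∃ (ι : Type v) (N : ι → Submodule R M),
    iSupIndep N ∧ iSup N = ⊤ ∧ ∀ i, IsDistributiveModule R (N i)

/-! ### Rings and algebras

The following two notions are the left-sided ones. The right-sided ones are the same notions for
the opposite ring `Rᵐᵒᵖ`, whose left modules are the right `R`-modules. -/

/-- A ring is (left) semidistributive if it is semidistributive as a left module over itself. -/
def IsSemidistributiveRing (R : Type u) [Ring R] : Prop :=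
  IsSemidistributiveModule R R

/-- A ring is (left) locally hereditary if every local submodule of an indecomposable projective
left module is projective. -/
def IsLocallyHereditary (R : Type u) [Ring R] : Prop :=
  ∀ (P : Type u) [AddCommGroup P] [Module R P],
    Module.Projective R P → IsIndecomposableModule R P →
      ∀ N : Submodule R P, IsLocalModule R N → Module.Projective R N

/-- An algebra over a field `K` is (basic) pointed if every simple module is one-dimensional
over `K`. For a finite-dimensional algebra this means that `A / J(A)` is a finite product of copies
of `K`; in particular such an algebra is basic. -/
def IsBasicPointed (K : Type u) (A : Type v) [Field K] [Ring A] [Algebra K A] : Prop :=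
  ∀ (S : Type v) [AddCommGroup S] [Module K S] [Module A S] [IsScalarTower K A S],
    IsSimpleModule A S → Module.finrank K S = 1

/-- For all indecomposable projective modules `P`, `Q`, `R`: the space `Hom(P, Q)` has dimension at
most one, and if `Hom(P, Q)` and `Hom(Q, R)` are both nonzero, then the composition map
`Hom(P, Q) × Hom(Q, R) → Hom(P, R)` is not the zero map. -/
def ProjectiveHomCondition (K : Type u) (A : Type v) [Field K] [Ring A] [Algebra K A] : Prop :=
  (∀ (P Q : Type v)
    [AddCommGroup P] [Module K P] [Module A P] [IsScalarTower K A P]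
    [AddCommGroup Q] [Module K Q] [Module A Q] [IsScalarTower K A Q],
    Module.Projective A P → IsIndecomposableModule A P →
    Module.Projective A Q → IsIndecomposableModule A Q →
      Module.rank K (P →ₗ[A] Q) ≤ 1) ∧
  (∀ (P Q R : Type v)
    [AddCommGroup P] [Module A P] [AddCommGroup Q] [Module A Q] [AddCommGroup R] [Module A R],
    Module.Projective A P → IsIndecomposableModule A P →
    Module.Projective A Q → IsIndecomposableModule A Q →
    Module.Projective A R → IsIndecomposableModule A R →
      (∃ f : P →ₗ[A] Q, f ≠ 0) → (∃ g : Q →ₗ[A] R, g ≠ 0) →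
        ∃ (f : P →ₗ[A] Q) (g : Q →ₗ[A] R), g ∘ₗ f ≠ 0)

/-! ### Deformations of incidence algebras -/

/-- The vector space `I(P, K)`, to be equipped with the multiplication deformed by a family
`lam x y z` of nonzero scalars. Only the values of `lam` at `x ≤ y ≤ z` matter. -/
def DeformedIncidenceAlgebra (K : Type u) (P : Type v) [Field K] [PartialOrder P]
    (_lam : P → P → P → Kˣ) : Type (max u v) :=
  IncidenceAlgebra K P

namespace DeformedIncidenceAlgebra

section

variable {K : Type u} {P : Type v} [Field K] [PartialOrder P] {lam : P → P → P → Kˣ}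

instance : AddCommGroup (DeformedIncidenceAlgebra K P lam) :=
  inferInstanceAs (AddCommGroup (IncidenceAlgebra K P))

noncomputable instance : Module K (DeformedIncidenceAlgebra K P lam) :=
  inferInstanceAs (Module K (IncidenceAlgebra K P))

instance : FunLike (DeformedIncidenceAlgebra K P lam) P (P → K) :=
  inferInstanceAs (FunLike (IncidenceAlgebra K P) P (P → K))

variable [LocallyFiniteOrder P]

/-- The deformed multiplication: the bilinear extension of
`f_{xy} * f_{yz} = lam x y z • f_{xz}` and `f_{xy} * f_{tz} = 0` for `y ≠ t`. -/
instance : Mul (DeformedIncidenceAlgebra K P lam) where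
  mul f g :=
    (⟨fun x z => ∑ y ∈ Finset.Icc x z, (lam x y z : K) * (f x y * g y z),
      fun x z h => by rw [Finset.Icc_eq_empty h, Finset.sum_empty]⟩ : IncidenceAlgebra K P)

theorem mul_apply (f g : DeformedIncidenceAlgebra K P lam) (x z : P) :
    (f * g) x z = ∑ y ∈ Finset.Icc x z, (lam x y z : K) * (f x y * g y z) := rfl

end

end DeformedIncidenceAlgebra

/-- `A` is (isomorphic to) a deformation `I_lam(P, K)` of the incidence algebra of a finite poset:
there is a multiplicative linear bijection onto it. No associativity of the deformed multiplication
is required, as it follows from the isomorphism; likewise the image of `1` is an identity. -/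
def IsDeformedIncidenceAlgebra (K : Type u) (A : Type v) [Field K] [Ring A] [Algebra K A] : Prop :=
  ∃ (P : Type) (_ : Fintype P) (_ : PartialOrder P) (_ : LocallyFiniteOrder P)
    (lam : P → P → P → Kˣ) (φ : A ≃ₗ[K] DeformedIncidenceAlgebra K P lam),
    ∀ a b : A, φ (a * b) = φ a * φ b

/-! Lift the standard idempotents of `A / J(A) = K^n` to idempotents `e i`. Every condition is
compared with one statement about the Peirce components `e i * A * e j`, namely `IsIncidenceLike`.
This statement is left-right symmetric (`isIncidenceLike_op`), and `Hom(A e_i, A e_j)` is `e i * A *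
e j`, so it is the Hom condition in other words.

If `A` is locally hereditary, a cyclic module `A x` with `x` in a Peirce component is local, hence
projective. The splitting of `A → A x` shows that composable nonzero components have nonzero
products (`mul_ne_zero_of_isLocallyHereditary`), so corners contain no nonzero nilpotents and equal
`K e_i`. The components are then at most one-dimensional by semidistributivity
(`exists_smul_eq_or_of_isDistributiveModule`), or by a pigeonhole argument over the infinite field
when there are finitely many ideals.

Conversely, an incidence-like system orders its index set by nonvanishing of components, and the
structure constants of chosen basis vectors are the scalars `lam`. -/

/-- A complete family of orthogonal idempotents `e i` of a `K`-algebra, together with characters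
`χ i` dual to it whose common kernel is nil. -/
structure PointedSystem (K : Type*) (A : Type*) (ι : Type*) [Field K] [Ring A] [Algebra K A]
    [Fintype ι] where
  e : ι → A
  χ : ι → A →ₐ[K] K
  complete : CompleteOrthogonalIdempotents e
  χ_self : ∀ i, χ i (e i) = 1
  isNilpotent : ∀ a, (∀ i, χ i a = 0) → IsNilpotent a

/-! ### Peirce calculus of a pointed system -/

namespace PointedSystem

variable {K A ι : Type*} [Field K] [Ring A] [Algebra K A] [Fintype ι]

section

variable (s : PointedSystem K A ι)

/-- Membership in the Peirce component `e i * A * e j`. -/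
def IsPeirce (i j : ι) (x : A) : Prop := s.e i * x = x ∧ x * s.e j = x

/-- The Peirce components are at most one-dimensional, and nonzero elements of composable
components have a nonzero product. -/
def IsIncidenceLike : Prop :=
  (∀ i j x y, s.IsPeirce i j x → s.IsPeirce i j y → x ≠ 0 → ∃ c : K, y = c • x) ∧
    ∀ i j k x y, s.IsPeirce i j x → s.IsPeirce j k y → x ≠ 0 → y ≠ 0 → x * y ≠ 0

theorem e_mul_e (i : ι) : s.e i * s.e i = s.e i := s.complete.idem i

theorem e_mul_e_of_ne {i j : ι} (h : i ≠ j) : s.e i * s.e j = 0 := s.complete.ortho h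

theorem sum_e : ∑ i, s.e i = 1 := s.complete.complete

theorem e_ne_zero (i : ι) : s.e i ≠ 0 := fun h => by
  have := s.χ_self i
  simp [h] at this

theorem χ_of_ne {i j : ι} (h : i ≠ j) : s.χ i (s.e j) = 0 := by
  have := congrArg (s.χ i) (s.e_mul_e_of_ne h)
  simpa [s.χ_self] using this

theorem isPeirce_e (i : ι) : s.IsPeirce i i (s.e i) := ⟨s.e_mul_e i, s.e_mul_e i⟩

theorem isPeirce_mul_mul (i j : ι) (a : A) : s.IsPeirce i j (s.e i * a * s.e j) :=
  ⟨by rw [← mul_assoc, ← mul_assoc, e_mul_e], by rw [mul_assoc, e_mul_e]⟩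

variable {s}

theorem IsPeirce.add {i j : ι} {x y : A} (hx : s.IsPeirce i j x) (hy : s.IsPeirce i j y) :
    s.IsPeirce i j (x + y) := ⟨by rw [mul_add, hx.1, hy.1], by rw [add_mul, hx.2, hy.2]⟩

theorem IsPeirce.smul {i j : ι} {x : A} (c : K) (hx : s.IsPeirce i j x) :
    s.IsPeirce i j (c • x) := ⟨by rw [mul_smul_comm, hx.1], by rw [smul_mul_assoc, hx.2]⟩

theorem IsPeirce.sub {i j : ι} {x y : A} (hx : s.IsPeirce i j x) (hy : s.IsPeirce i j y) :
    s.IsPeirce i j (x - y) := ⟨by rw [mul_sub, hx.1, hy.1], by rw [sub_mul, hx.2, hy.2]⟩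

theorem IsPeirce.mul {i j k : ι} {x y : A} (hx : s.IsPeirce i j x) (hy : s.IsPeirce j k y) :
    s.IsPeirce i k (x * y) := ⟨by rw [← mul_assoc, hx.1], by rw [mul_assoc, hy.2]⟩

theorem IsPeirce.χ_left {i j l : ι} {x : A} (hx : s.IsPeirce i j x) (h : l ≠ i) :
    s.χ l x = 0 := by
  rw [← hx.1, map_mul, s.χ_of_ne h, zero_mul]

theorem IsPeirce.χ_right {i j l : ι} {x : A} (hx : s.IsPeirce i j x) (h : l ≠ j) :
    s.χ l x = 0 := by
  rw [← hx.2, map_mul, s.χ_of_ne h, mul_zero]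

theorem IsPeirce.isNilpotent {i : ι} {x : A} (hx : s.IsPeirce i i x) (h : s.χ i x = 0) :
    IsNilpotent x :=
  s.isNilpotent x fun l => by
    by_cases hl : l = i
    · rw [hl, h]
    · exact hx.χ_left hl

theorem IsPeirce.mul_eq_zero {i j k l : ι} {x y : A} (hx : s.IsPeirce i j x)
    (hy : s.IsPeirce k l y) (h : j ≠ k) : x * y = 0 := by
  rw [← hx.2, ← hy.1, mul_assoc, ← mul_assoc (s.e j), s.e_mul_e_of_ne h, zero_mul, mul_zero]

variable (s)

/-- Elements of a corner with nonzero character are invertible in the corner. -/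
theorem exists_corner_inverse {i : ι} {u : A} (hu : s.IsPeirce i i u) (h : s.χ i u ≠ 0) :
    ∃ v, s.IsPeirce i i v ∧ v * u = s.e i ∧ u * v = s.e i := by
  set c := s.χ i u with hc
  -- Filling the complementary corner with `c` makes every character of `w` equal to `c`, so `w` is
  -- a nonzero scalar plus a nilpotent.
  set w := u + c • (1 - s.e i) with hw
  have hnil : IsNilpotent (w - algebraMap K A c) := by
    refine s.isNilpotent _ fun l => ?_
    by_cases hl : l = i
    · subst hl
      simp [hw, ← hc, s.χ_self]
    · simp [hw, hu.χ_left hl, s.χ_of_ne hl]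
  have hunit : IsUnit w := by
    have h1 : IsUnit (algebraMap K A c) := (IsUnit.mk0 c h).map _
    have := (Algebra.commutes c (w - algebraMap K A c) : Commute _ _)
    have := hnil.isUnit_add_left_of_commute h1 this.symm
    simpa using this
  obtain ⟨w', hw'⟩ := hunit
  have hwe : w * s.e i = u := by
    simp [hw, add_mul, sub_mul, s.e_mul_e, hu.2]
  have hew : s.e i * w = u := by
    simp [hw, mul_add, mul_sub, s.e_mul_e, hu.1]
  have h1 : (↑w'⁻¹ : A) * u = s.e i := by
    rw [← hwe, ← hw', ← mul_assoc, Units.inv_mul, one_mul]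
  have h2 : u * (↑w'⁻¹ : A) = s.e i := by
    rw [← hew, ← hw', mul_assoc, Units.mul_inv, mul_one]
  refine ⟨s.e i * ↑w'⁻¹ * s.e i, s.isPeirce_mul_mul _ _ _, ?_, ?_⟩
  · rw [mul_assoc, hu.1, mul_assoc, h1, e_mul_e]
  · rw [← mul_assoc, ← mul_assoc, hu.2, h2, e_mul_e]

theorem exists_mul_eq_e {i : ι} {a : A} (h : s.χ i a ≠ 0) :
    ∃ v, s.IsPeirce i i v ∧ v * (s.e i * a * s.e i) = s.e i ∧ s.e i * a * s.e i * v = s.e i :=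
  s.exists_corner_inverse (s.isPeirce_mul_mul i i a) (by simpa [s.χ_self] using h)

theorem exists_e_mul_ne_zero {M : Type*} [AddCommGroup M] [Module A M] {m : M} (hm : m ≠ 0) :
    ∃ i, s.e i • m ≠ 0 := by
  by_contra! h
  apply hm
  rw [← one_smul A m, ← s.sum_e, Finset.sum_smul, Finset.sum_eq_zero fun i _ => h i]

theorem sum_sum_eq (a : A) : ∑ i, ∑ j, s.e i * a * s.e j = a := by
  simp_rw [← Finset.mul_sum, s.sum_e, mul_one, ← Finset.sum_mul, s.sum_e, one_mul]

theorem mem_jacobson {a : A} (h : ∀ i, s.χ i a = 0) : a ∈ Ring.jacobson A := by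
  rw [← Ideal.jacobson_bot, Ideal.mem_jacobson_iff]
  intro y
  obtain ⟨u, hu⟩ : IsUnit (y * a + 1) :=
    (s.isNilpotent (y * a) fun i => by rw [map_mul, h, mul_zero]).isUnit_add_one
  refine ⟨↑u⁻¹, ?_⟩
  rw [Ideal.mem_bot, mul_assoc, ← mul_add_one, ← hu, Units.inv_mul, sub_self]

/-- The system induced on the opposite algebra. -/
def op : PointedSystem K Aᵐᵒᵖ ι where
  e i := MulOpposite.op (s.e i)
  χ i := (s.χ i).fromOpposite fun _ _ => mul_comm _ _
  complete :=
    { idem := fun i => congrArg MulOpposite.op (s.e_mul_e i)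
      ortho := fun _ _ h => congrArg MulOpposite.op (s.e_mul_e_of_ne h.symm)
      complete := by rw [← Finset.op_sum, s.sum_e, MulOpposite.op_one] }
  χ_self i := s.χ_self i
  isNilpotent a h := by
    obtain ⟨n, hn⟩ := s.isNilpotent a.unop h
    exact ⟨n, by rw [← MulOpposite.op_unop a, ← MulOpposite.op_pow, hn, MulOpposite.op_zero]⟩

variable {s}

theorem isPeirce_op {i j : ι} {x : Aᵐᵒᵖ} : s.op.IsPeirce i j x ↔ s.IsPeirce j i x.unop := by
  constructor
  · rintro ⟨h1, h2⟩
    exact ⟨congrArg MulOpposite.unop h2, congrArg MulOpposite.unop h1⟩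
  · rintro ⟨h1, h2⟩
    exact ⟨congrArg MulOpposite.op h2, congrArg MulOpposite.op h1⟩

/-- This symmetry is what carries the left-sided conditions over to the right-sided ones. -/
theorem isIncidenceLike_op : s.op.IsIncidenceLike ↔ s.IsIncidenceLike := by
  simp only [IsIncidenceLike, isPeirce_op]
  constructor
  · rintro ⟨h1, h2⟩
    refine ⟨fun i j x y hx hy h => ?_, fun i j k x y hx hy h h' h0 => ?_⟩
    · obtain ⟨c, hc⟩ := h1 j i (.op x) (.op y) hx hy (by simpa using h)
      exact ⟨c, congrArg MulOpposite.unop hc⟩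
    · exact h2 k j i (.op y) (.op x) hy hx (by simpa using h') (by simpa using h)
        (congrArg MulOpposite.op h0)
  · rintro ⟨h1, h2⟩
    refine ⟨fun i j x y hx hy h => ?_, fun i j k x y hx hy h h' h0 => ?_⟩
    · obtain ⟨c, hc⟩ := h1 j i x.unop y.unop hx hy (by simpa using h)
      exact ⟨c, congrArg MulOpposite.op hc⟩
    · exact h2 k j i y.unop x.unop hy hx (by simpa using h') (by simpa using h)
        (congrArg MulOpposite.unop h0)

end

end PointedSystem

/-! ### Existence of a pointed system -/

section Existence

variable {K : Type u} {A : Type v} [Field K] [Ring A] [Algebra K A] [FiniteDimensional K A]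

/-- For a maximal left ideal `m` the quotient `A ⧸ m` is a line, so its action is a character. It
kills `a`, hence `a ∈ m`. Thus `a` lies in the Jacobson radical, which is nilpotent. -/
theorem IsBasicPointed.isNilpotent (hA : IsBasicPointed K A) {a : A}
    (ha : ∀ ψ : A →ₐ[K] K, ψ a = 0) : IsNilpotent a := by
  have := IsArtinianRing.of_finite K A
  suffices a ∈ Ring.jacobson A by
    obtain ⟨n, hn⟩ := IsSemiprimaryRing.isNilpotent (R := A)
    exact ⟨n, by simpa [hn] using Ideal.pow_mem_pow this n⟩
  rw [← Ideal.jacobson_bot, Ideal.jacobson, Ideal.mem_sInf]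
  rintro m ⟨-, hm⟩
  have hsimple : IsSimpleModule A (A ⧸ m) := isSimpleModule_iff_isCoatom.mpr hm.out
  have hrank := hA (A ⧸ m) hsimple
  let E : K ≃ₐ[K] Module.End K (A ⧸ m) := AlgEquiv.ofBijective (Algebra.ofId K _)
    (LinearEquiv.smul_id_of_finrank_eq_one hrank).bijective
  have h := ha (E.symm.toAlgHom.comp (Algebra.lsmul K K (A ⧸ m)))
  have h' : Algebra.lsmul K K (A ⧸ m) a = 0 := by simpa using h
  have := LinearMap.congr_fun h' (Submodule.Quotient.mk 1)
  rw [← Submodule.Quotient.mk_eq_zero]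
  simpa [← Submodule.Quotient.mk_smul] using this

/-- Characters are linearly independent, so there are finitely many and together they map `A` onto
`K^n`. The kernel is nil, so idempotents lift. -/
theorem IsBasicPointed.exists_pointedSystem (hA : IsBasicPointed K A) :
    ∃ n, Nonempty (PointedSystem K A (Fin n)) := by
  have hli := linearIndependent_toLinearMap K A K
  have hfin : Finite (A →ₐ[K] K) := hli.finite
  obtain ⟨n, ⟨E⟩⟩ := Finite.exists_equiv_fin (A →ₐ[K] K)
  let χ : Fin n → A →ₐ[K] K := E.symm
  let Φ : A →ₐ[K] (Fin n → K) := AlgHom.pi χ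
  have hsurj : Function.Surjective Φ := by
    rw [← AlgHom.coe_toLinearMap, ← LinearMap.range_eq_top]
    by_contra h
    -- A functional vanishing on a proper range is a linear relation among the characters.
    obtain ⟨f, hf, hle⟩ := Submodule.exists_le_ker_of_lt_top _ (lt_top_iff_ne_top.mpr h)
    apply hf
    have hli' := hli.comp χ E.symm.injective
    rw [Fintype.linearIndependent_iff] at hli'
    have := hli' (fun i => f (Pi.single i 1)) (by
      ext a
      have h1 : f (Φ a) = 0 := hle ⟨a, rfl⟩
      rw [← Finset.univ_sum_single (Φ a), map_sum] at h1
      have h2 (i : Fin n) : f (Pi.single i (Φ a i)) = f (Pi.single i 1) * χ i a := by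
        rw [← mul_one (Φ a i), ← smul_eq_mul, Pi.single_smul, map_smul, smul_eq_mul, mul_comm]
        rfl
      simpa [h2] using h1)
    refine LinearMap.pi_ext' fun i => LinearMap.ext_ring ?_
    simpa using this i
  have hker : ∀ a, (∀ i, χ i a = 0) → IsNilpotent a := fun a h =>
    hA.isNilpotent fun ψ => by simpa [χ] using h (E ψ)
  obtain ⟨e, he, hΦ⟩ := CompleteOrthogonalIdempotents.lift_of_isNilpotent_ker
    (Φ : A →+* (Fin n → K)) (fun a ha => hker a fun i => congrFun ha i)
    (CompleteOrthogonalIdempotents.single fun _ : Fin n => K) (fun i => hsurj _)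
  refine ⟨n, ⟨⟨e, χ, he, fun i => ?_, hker⟩⟩⟩
  have := congrFun (congrFun hΦ i) i
  simpa [Φ] using this

end Existence

/-! ### Generalities on modules -/

theorem IsLocalModule.isIndecomposableModule {R : Type*} {M : Type*} [Ring R] [AddCommGroup M]
    [Module R M] (h : IsLocalModule R M) : IsIndecomposableModule R M := by
  obtain ⟨N, hN, hmax⟩ := h
  refine ⟨(Submodule.nontrivial_iff R).mp ⟨N, ⊤, hN⟩, fun X Y hXY => ?_⟩
  by_cases hX : X = ⊤
  · right
    simpa [hX] using hXY.inf_eq_bot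
  · by_cases hY : Y = ⊤
    · left
      simpa [hY] using hXY.inf_eq_bot
    · exact absurd (top_le_iff.mp (hXY.sup_eq_top ▸ sup_le (hmax X hX) (hmax Y hY))) hN

/-- A split epimorphism from an indecomposable module onto a nonzero module is injective. -/
theorem IsIndecomposableModule.injective_of_comp_eq_id {R M N : Type*} [Ring R] [AddCommGroup M]
    [Module R M] [AddCommGroup N] [Module R N] [Nontrivial N] (h : IsIndecomposableModule R M)
    (f : M →ₗ[R] N) (g : N →ₗ[R] M) (hfg : f ∘ₗ g = LinearMap.id) : Function.Injective f := by
  have hfg' (y : N) : f (g y) = y := LinearMap.congr_fun hfg y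
  have hc : IsCompl (LinearMap.ker f) (LinearMap.range g) := by
    refine IsCompl.of_eq ?_ ?_
    · rw [eq_bot_iff]
      rintro _ ⟨hx, y, rfl⟩
      have : f (g y) = 0 := hx
      rw [hfg'] at this
      simp [this]
    · rw [eq_top_iff]
      intro x _
      exact Submodule.mem_sup.mpr ⟨x - g (f x), by simp [hfg'], g (f x), ⟨_, rfl⟩, by simp⟩
  rcases h.2 _ _ hc with h | h
  · exact LinearMap.ker_eq_bot.mp h
  · exfalso
    obtain ⟨y, hy⟩ := exists_ne (0 : N)
    apply hy
    rw [← hfg' y, LinearMap.range_eq_bot.mp h]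
    simp

theorem IsDistributiveModule.of_injective {R M N : Type*} [Ring R] [AddCommGroup M]
    [Module R M] [AddCommGroup N] [Module R N] (h : IsDistributiveModule R N)
    (f : M →ₗ[R] N) (hf : Function.Injective f) : IsDistributiveModule R M := by
  intro X Y Z
  apply Submodule.map_injective_of_injective hf
  simp only [Submodule.map_sup, Submodule.map_inf f hf, h _ _ _]

/-! ### Local modules and indecomposable projectives -/

namespace PointedSystem

variable {K : Type*} {A : Type v} {ι : Type*} [Field K] [Ring A] [Algebra K A] [Fintype ι]
  (s : PointedSystem K A ι)

/-- The largest proper submodule is `ker (χ i) • m`. It omits `m`, since a nilpotent corner element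
cannot fix `m ≠ 0`. If `χ i a ≠ 0`, the corner part of `a` is invertible and `a • m` generates
everything. -/
theorem isLocalModule_of_span_eq_top {M : Type*} [AddCommGroup M] [Module A M] {i : ι} {m : M}
    (hm : s.e i • m = m) (h0 : m ≠ 0) (htop : Submodule.span A {m} = ⊤) : IsLocalModule A M := by
  have hgen (l : M) : ∃ a : A, a • m = l := Submodule.mem_span_singleton.mp (htop ▸ trivial)
  refine ⟨Submodule.map (LinearMap.toSpanSingleton A M m) (RingHom.ker (s.χ i)),
    fun h => ?_, fun L hL => ?_⟩
  · obtain ⟨a, ha, ham⟩ : m ∈ Submodule.map (LinearMap.toSpanSingleton A M m)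
      (RingHom.ker (s.χ i)) := h ▸ trivial
    have ha : s.χ i a = 0 := ha
    have ham : a • m = m := ham
    obtain ⟨n, hn⟩ := (s.isPeirce_mul_mul i i a).isNilpotent (by simp [ha])
    have h1 : (s.e i * a * s.e i) • m = m := by rw [mul_smul, mul_smul, hm, ham, hm]
    have h2 (n : ℕ) : (s.e i * a * s.e i) ^ n • m = m := by
      induction n with
      | zero => simp
      | succ n ih => rw [pow_succ, mul_smul, h1, ih]
    exact h0 (by rw [← h2 n, hn, zero_smul])
  · intro l hl
    obtain ⟨a, rfl⟩ := hgen l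
    refine ⟨a, ?_, rfl⟩
    by_contra ha
    obtain ⟨v, -, hv, -⟩ := s.exists_mul_eq_e (a := a) (i := i) ha
    apply hL
    rw [eq_top_iff, ← htop, Submodule.span_singleton_le_iff_mem]
    have : (v * s.e i) • a • m = m := by
      conv_rhs => rw [← hm, ← hv]
      simp only [mul_smul, hm]
    exact this ▸ L.smul_mem _ hl

/-- The projective left ideal generated by `e i`. -/
def leftIdeal (i : ι) : Submodule A A := Submodule.span A {s.e i}

theorem mem_leftIdeal {i : ι} {x : A} : x ∈ s.leftIdeal i ↔ x * s.e i = x := by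
  rw [leftIdeal, Submodule.mem_span_singleton]
  constructor
  · rintro ⟨a, rfl⟩
    rw [smul_eq_mul, mul_assoc, e_mul_e]
  · exact fun h => ⟨x, h⟩

/-- The generator of `s.leftIdeal i`. -/
def gen (i : ι) : s.leftIdeal i := ⟨s.e i, s.mem_leftIdeal.mpr (s.e_mul_e i)⟩

theorem coe_smul_gen {i : ι} (x : s.leftIdeal i) : (x : A) • s.gen i = x :=
  Subtype.ext (s.mem_leftIdeal.mp x.2)

theorem e_smul_gen (i : ι) : s.e i • s.gen i = s.gen i := s.coe_smul_gen (s.gen i)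

theorem gen_ne_zero (i : ι) : s.gen i ≠ 0 := fun h => s.e_ne_zero i (congrArg Subtype.val h)

instance (i : ι) : Module.Projective A (s.leftIdeal i) :=
  Module.Projective.of_split (M := A) (s.leftIdeal i).subtype
    (LinearMap.toSpanSingleton A _ (s.gen i)) (LinearMap.ext fun x => s.coe_smul_gen x)

instance (i : ι) : Nontrivial (s.leftIdeal i) := ⟨⟨s.gen i, 0, s.gen_ne_zero i⟩⟩

theorem isIndecomposableModule_leftIdeal (i : ι) : IsIndecomposableModule A (s.leftIdeal i) :=
  (s.isLocalModule_of_span_eq_top (s.e_smul_gen i) (s.gen_ne_zero i)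
    (eq_top_iff.mpr fun x _ => Submodule.mem_span_singleton.mpr
      ⟨x, s.coe_smul_gen x⟩)).isIndecomposableModule

/-- Over an artinian algebra, every indecomposable projective module is generated by an
idempotent of the system. -/
theorem exists_leftIdeal_equiv [IsArtinianRing A] (P : Type*) [AddCommGroup P] [Module A P]
    [Module.Projective A P] (hP : IsIndecomposableModule A P) :
    ∃ i, Nonempty (s.leftIdeal i ≃ₗ[A] P) := by
  obtain ⟨t, ht⟩ := Module.projective_def'.mp ‹Module.Projective A P›
  have ht' (p : P) : ((t p).sum fun q a => a • q) = p := LinearMap.congr_fun ht p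
  -- Here `t` embeds `P` as a summand of a free module. If all coordinates lay in the radical `J`,
  -- then `P = J ^ n • P` for every `n`, so `P = 0`.
  obtain ⟨p, q, i, hpq⟩ : ∃ p q i, s.χ i (t p q) ≠ 0 := by
    by_contra! h
    obtain ⟨n, hn⟩ := IsSemiprimaryRing.isNilpotent (R := A)
    have key (n : ℕ) (p : P) : p ∈ (Ring.jacobson A ^ n) • (⊤ : Submodule A P) := by
      induction n generalizing p with
      | zero =>
        rw [← one_smul A p]
        exact Submodule.smul_mem_smul (by rw [Submodule.pow_zero, Ideal.one_eq_top]; trivial) trivial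
      | succ n ih =>
        rw [← ht' p]
        refine Submodule.sum_mem _ fun q _ => ?_
        rw [Ideal.IsTwoSided.pow_succ]
        have := Submodule.smul_mem_smul (s.mem_jacobson (h p q)) (ih q)
        rwa [← Submodule.mul_smul] at this
    have := hP.1
    obtain ⟨y, hy⟩ := exists_ne (0 : P)
    apply hy
    have := key n y
    rw [hn] at this
    simpa using this
  refine ⟨i, ?_⟩
  obtain ⟨v, -, hv, -⟩ := s.exists_mul_eq_e hpq
  let f : P →ₗ[A] s.leftIdeal i :=
    LinearMap.toSpanSingleton A _ (s.gen i) ∘ₗ Finsupp.lapply q ∘ₗ t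
  let g : s.leftIdeal i →ₗ[A] P :=
    LinearMap.toSpanSingleton A P ((v * s.e i) • p) ∘ₗ (s.leftIdeal i).subtype
  have hfg : f ∘ₗ g = LinearMap.id := by
    refine LinearMap.ext fun x => Subtype.ext ?_
    have hx := s.mem_leftIdeal.mp x.2
    calc t ((x : A) • (v * s.e i) • p) q * s.e i
        = x * (v * (s.e i * t p q * s.e i)) := by simp [mul_assoc]
      _ = x := by rw [hv, hx]
  exact ⟨(LinearEquiv.ofBijective f ⟨hP.injective_of_comp_eq_id f g hfg,
    fun x => ⟨g x, LinearMap.congr_fun hfg x⟩⟩).symm⟩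

/-! ### Consequences of being locally hereditary -/

section

variable {s} (h : IsLocallyHereditary A)
include h

/-- The submodule `A x` of `A e_k` is local, so `A → A x` has a section sending `x` to some `t` with
`t x = x`. If `a x = 0` then `a t = 0`; but `t` is invertible in the corner at `j`, so `a = 0`. -/
theorem mul_ne_zero_of_isLocallyHereditary {i j k : ι} {a x : A} (ha : s.IsPeirce i j a)
    (hx : s.IsPeirce j k x) (ha0 : a ≠ 0) (hx0 : x ≠ 0) : a * x ≠ 0 := by
  let x' : s.leftIdeal k := ⟨x, s.mem_leftIdeal.mpr hx.2⟩
  let N : Submodule A (s.leftIdeal k) := Submodule.span A {x'}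
  let y : N := ⟨x', Submodule.mem_span_singleton_self _⟩
  have hsurj : Function.Surjective (LinearMap.toSpanSingleton A N y) := by
    rintro ⟨z, hz⟩
    obtain ⟨b, rfl⟩ := Submodule.mem_span_singleton.mp hz
    exact ⟨b, rfl⟩
  have hy0 : y ≠ 0 := fun h => hx0 (congrArg (fun z : N => ((z : s.leftIdeal k) : A)) h)
  have hey : s.e j • y = y := Subtype.ext (Subtype.ext hx.1)
  have htop : Submodule.span A {y} = ⊤ := eq_top_iff.mpr fun z _ =>
    Submodule.mem_span_singleton.mpr (hsurj z)
  have := h _ inferInstance (s.isIndecomposableModule_leftIdeal k) N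
    (s.isLocalModule_of_span_eq_top hey hy0 htop)
  obtain ⟨σ, hσ⟩ := Module.projective_lifting_property
    (LinearMap.toSpanSingleton A N y) LinearMap.id hsurj
  set t := σ y with ht
  have hty : t • y = y := LinearMap.congr_fun hσ y
  have hχ : s.χ j t ≠ 0 := by
    intro h0
    obtain ⟨n, hn⟩ := (s.isPeirce_mul_mul j j t).isNilpotent (by simp [h0])
    have h1 : (s.e j * t * s.e j) • y = y := by rw [mul_smul, mul_smul, hey, hty, hey]
    have h2 (n : ℕ) : (s.e j * t * s.e j) ^ n • y = y := by
      induction n with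
      | zero => simp
      | succ n ih => rw [pow_succ, mul_smul, h1, ih]
    exact hy0 (by rw [← h2 n, hn, zero_smul])
  obtain ⟨v, -, -, hv⟩ := s.exists_mul_eq_e hχ
  intro hax
  have hay : a • y = 0 := Subtype.ext (Subtype.ext hax)
  have hat : a * t = 0 := by
    rw [← smul_eq_mul, ht, ← map_smul, hay, map_zero]
  apply ha0
  rw [← ha.2, ← hv, ← mul_assoc, ← mul_assoc, ← mul_assoc, ha.2, hat, zero_mul, zero_mul]

/-- Subtracting `χ i x • e i` leaves a nilpotent corner element, while powers of a nonzero corner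
element never vanish. -/
theorem exists_eq_smul_e_of_isLocallyHereditary {i : ι} {x : A} (hx : s.IsPeirce i i x) :
    ∃ c : K, x = c • s.e i := by
  refine ⟨s.χ i x, ?_⟩
  have hy : s.IsPeirce i i (x - s.χ i x • s.e i) := hx.sub ((s.isPeirce_e i).smul _)
  obtain ⟨n, hn⟩ := hy.isNilpotent (by simp [s.χ_self])
  by_contra hne
  have hy0 := sub_ne_zero.mpr hne
  have key (n : ℕ) : s.IsPeirce i i ((x - s.χ i x • s.e i) ^ (n + 1)) ∧
      (x - s.χ i x • s.e i) ^ (n + 1) ≠ 0 := by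
    induction n with
    | zero => simpa using ⟨hy, hy0⟩
    | succ n ih =>
      rw [pow_succ]
      exact ⟨ih.1.mul hy, mul_ne_zero_of_isLocallyHereditary h ih.1 hy ih.2 hy0⟩
  exact (key n).2 (by rw [pow_succ, hn, zero_mul])

end

/-! ### Bounding the dimension of Peirce components -/

/-- Distributivity splits `p + q` into parts in `A(p+q) ∩ Ap` and `A(p+q) ∩ Aq`. After applying `e
i` all coefficients are scalars, because corners are `K e_i`. -/
theorem exists_smul_eq_or_of_isDistributiveModule
    (hdiag : ∀ i x, s.IsPeirce i i x → ∃ c : K, x = c • s.e i) {M : Type*} [AddCommGroup M]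
    [Module K M] [Module A M] [IsScalarTower K A M] (hM : IsDistributiveModule A M) {i : ι}
    {p q : M} (hp : s.e i • p = p) (hq : s.e i • q = q) :
    (∃ c : K, p = c • q) ∨ ∃ c : K, q = c • p := by
  have hscalar (a : A) : ∃ c : K, ∀ m : M, s.e i • m = m → s.e i • a • m = c • m := by
    obtain ⟨c, hc⟩ := hdiag i _ (s.isPeirce_mul_mul i i a)
    refine ⟨c, fun m hm => ?_⟩
    calc s.e i • a • m = (s.e i * a * s.e i) • m := by rw [mul_smul, mul_smul, hm]
      _ = c • m := by rw [hc, smul_assoc, hm]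
  have hpq : s.e i • (p + q) = p + q := by rw [smul_add, hp, hq]
  have hmem : p + q ∈ Submodule.span A {p + q} ⊓
      (Submodule.span A {p} ⊔ Submodule.span A {q}) :=
    ⟨Submodule.mem_span_singleton_self _,
      Submodule.add_mem_sup (Submodule.mem_span_singleton_self _)
        (Submodule.mem_span_singleton_self _)⟩
  rw [hM] at hmem
  obtain ⟨w₁, ⟨h1, h2⟩, w₂, ⟨h3, h4⟩, hw⟩ := Submodule.mem_sup.mp hmem
  obtain ⟨a₁, rfl⟩ := Submodule.mem_span_singleton.mp h1
  obtain ⟨b₁, hb₁⟩ := Submodule.mem_span_singleton.mp h2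
  obtain ⟨a₂, rfl⟩ := Submodule.mem_span_singleton.mp h3
  obtain ⟨b₂, hb₂⟩ := Submodule.mem_span_singleton.mp h4
  obtain ⟨c₁, hc₁⟩ := hscalar a₁
  obtain ⟨c₂, hc₂⟩ := hscalar a₂
  obtain ⟨d₁, hd₁⟩ := hscalar b₁
  obtain ⟨d₂, hd₂⟩ := hscalar b₂
  have e1 : d₁ • p = c₁ • (p + q) := by rw [← hd₁ p hp, hb₁, hc₁ _ hpq]
  have e2 : d₂ • q = c₂ • (p + q) := by rw [← hd₂ q hq, hb₂, hc₂ _ hpq]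
  have e3 : c₁ • (p + q) + c₂ • (p + q) = p + q := by
    rw [← hc₁ _ hpq, ← hc₂ _ hpq, ← smul_add, hw, hpq]
  -- A nonzero `c₁` makes `q` a multiple of `p`, a nonzero `c₂` makes `p` a multiple of `q`, and if
  -- both vanish then `p + q = 0`.
  by_cases h₁ : c₁ = 0
  · by_cases h₂ : c₂ = 0
    · left
      refine ⟨-1, ?_⟩
      rw [h₁, h₂, zero_smul, add_zero] at e3
      rw [neg_one_smul]
      exact eq_neg_of_add_eq_zero_left e3.symm
    · left
      refine ⟨c₂⁻¹ * (d₂ - c₂), ?_⟩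
      rw [mul_smul, sub_smul, e2, smul_add, add_sub_cancel_right, inv_smul_smul₀ h₂]
  · right
    refine ⟨c₁⁻¹ * (d₁ - c₁), ?_⟩
    rw [mul_smul, sub_smul, e1, smul_add, add_sub_cancel_left, inv_smul_smul₀ h₁]

variable {s}

theorem isIncidenceLike_of_isSemidistributiveRing (h : IsLocallyHereditary A)
    (hsd : IsSemidistributiveRing A) : s.IsIncidenceLike := by
  refine ⟨fun i j x y hx hy hx0 => ?_,
    fun i j k x y hx hy => mul_ne_zero_of_isLocallyHereditary h hx hy⟩
  obtain ⟨κ, N, -, hN, hdist⟩ := hsd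
  -- Right multiplication by such an `n` is injective on `A e_j`, so it embeds `e i * A * e j` into
  -- a distributive summand.
  obtain ⟨l, n, hn, hχ⟩ : ∃ l, ∃ n ∈ N l, s.χ j n ≠ 0 := by
    by_contra! hcon
    have hle : iSup N ≤ RingHom.ker (s.χ j) := iSup_le hcon
    have : s.χ j (s.e j) = 0 := hle (hN ▸ trivial)
    simp [s.χ_self] at this
  obtain ⟨v, -, -, hv⟩ := s.exists_mul_eq_e hχ
  have hcancel (z : A) (hz : z * s.e j = z) (h0 : z * n = 0) : z = 0 := by
    rw [← hz, ← hv, ← mul_assoc, ← mul_assoc, ← mul_assoc, hz, h0, zero_mul, zero_mul]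
  rcases s.exists_smul_eq_or_of_isDistributiveModule
    (fun i x => exists_eq_smul_e_of_isLocallyHereditary h) (hdist l) (i := i)
    (p := x • ⟨n, hn⟩) (q := y • ⟨n, hn⟩) (by rw [← mul_smul, hx.1])
    (by rw [← mul_smul, hy.1]) with ⟨c, hc⟩ | ⟨c, hc⟩
  · have hc' : x * n = c • (y * n) := congrArg Subtype.val hc
    have hxy : x = c • y := sub_eq_zero.mp <| hcancel _ (hx.sub (hy.smul c)).2 (by
      rw [sub_mul, smul_mul_assoc, hc', sub_self])
    have hc0 : c ≠ 0 := by
      rintro rfl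
      exact hx0 (by rw [hxy, zero_smul])
    exact ⟨c⁻¹, by rw [hxy, inv_smul_smul₀ hc0]⟩
  · have hc' : y * n = c • (x * n) := congrArg Subtype.val hc
    exact ⟨c, sub_eq_zero.mp <| hcancel _ (hy.sub (hx.smul c)).2 (by
      rw [sub_mul, smul_mul_assoc, hc', sub_self])⟩

/-- Among the ideals generated by `y + c • x` two coincide. Since corners are scalar, the `(i, j)`
component of the ideal of `y + d • x` is just the line it spans, so `y + c • x` and `y + d • x` are
proportional with `c ≠ d`. -/
theorem isIncidenceLike_of_finite_twoSidedIdeal [Infinite K] (h : IsLocallyHereditary A)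
    (hfin : Finite (TwoSidedIdeal A)) : s.IsIncidenceLike := by
  refine ⟨fun i j x y hx hy hx0 => ?_,
    fun i j k x y hx hy => mul_ne_zero_of_isLocallyHereditary h hx hy⟩
  obtain ⟨c, d, hcd, heq⟩ := Finite.exists_ne_map_eq_of_infinite
    fun c : K => TwoSidedIdeal.span {y + c • x}
  have hd : s.IsPeirce i j (y + d • x) := hy.add (hx.smul d)
  have key : ∀ z ∈ TwoSidedIdeal.span {y + d • x}, ∃ r : K,
      s.e i * z * s.e j = r • (y + d • x) := by
    intro z hz
    rw [TwoSidedIdeal.mem_span_iff_mem_addSubgroup_closure] at hz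
    induction hz using AddSubgroup.closure_induction with
    | mem z hz =>
      obtain ⟨_, ⟨a, -, _, rfl, rfl⟩, b, -, rfl⟩ := hz
      obtain ⟨r, hr⟩ := exists_eq_smul_e_of_isLocallyHereditary h (s.isPeirce_mul_mul i i a)
      obtain ⟨r', hr'⟩ := exists_eq_smul_e_of_isLocallyHereditary h (s.isPeirce_mul_mul j j b)
      refine ⟨r * r', ?_⟩
      calc s.e i * (a * (y + d • x) * b) * s.e j
          = s.e i * (a * (s.e i * (y + d • x) * s.e j) * b) * s.e j := by rw [hd.1, hd.2]
        _ = (s.e i * a * s.e i) * (y + d • x) * (s.e j * b * s.e j) := by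
          simp only [mul_assoc]
        _ = (r * r') • (y + d • x) := by
          rw [hr, hr', smul_mul_assoc, hd.1, mul_smul_comm, smul_mul_assoc, hd.2, smul_smul,
            mul_comm]
    | zero => exact ⟨0, by simp⟩
    | add z w _ _ hz hw =>
      obtain ⟨r, hr⟩ := hz
      obtain ⟨r', hr'⟩ := hw
      exact ⟨r + r', by rw [mul_add, add_mul, hr, hr', add_smul]⟩
    | neg z _ hz =>
      obtain ⟨r, hr⟩ := hz
      exact ⟨-r, by rw [mul_neg, neg_mul, hr, neg_smul]⟩
  have hc : s.IsPeirce i j (y + c • x) := hy.add (hx.smul c)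
  have heq' : TwoSidedIdeal.span {y + c • x} = TwoSidedIdeal.span {y + d • x} := heq
  obtain ⟨r, hr⟩ := key (y + c • x) (heq' ▸ TwoSidedIdeal.subset_span rfl)
  rw [hc.1, hc.2] at hr
  by_cases hr1 : r = 1
  · exfalso
    rw [hr1, one_smul, add_right_inj] at hr
    exact hcd (smul_left_injective K hx0 hr)
  · refine ⟨(1 - r)⁻¹ * (r * d - c), ?_⟩
    rw [mul_smul, eq_inv_smul_iff₀ (sub_ne_zero.mpr (Ne.symm hr1)), sub_smul, sub_smul, one_smul,
      mul_smul, sub_eq_sub_iff_add_eq_add, hr, smul_add, add_comm]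

end PointedSystem

/-! ### Incidence-like systems and the module-theoretic conditions -/

namespace PointedSystem

section

variable {K : Type*} {A : Type v} {ι : Type*} [Field K] [Ring A] [Algebra K A] [Fintype ι]
  {s : PointedSystem K A ι}

/-- Right multiplication by an element of `e i * A * e j`. -/
def rightMul (s : PointedSystem K A ι) {i j : ι} {x : A} (hx : s.IsPeirce i j x) :
    s.leftIdeal i →ₗ[A] s.leftIdeal j :=
  LinearMap.toSpanSingleton A _ ⟨x, s.mem_leftIdeal.mpr hx.2⟩ ∘ₗ (s.leftIdeal i).subtype

theorem coe_rightMul_gen {i j : ι} {x : A} (hx : s.IsPeirce i j x) :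
    (s.rightMul hx (s.gen i) : A) = x := hx.1

theorem rightMul_ne_zero {i j : ι} {x : A} (hx : s.IsPeirce i j x) (h0 : x ≠ 0) :
    s.rightMul hx ≠ 0 := fun h => h0 (by rw [← coe_rightMul_gen hx, h]; rfl)

theorem isPeirce_map_gen {i j : ι} (f : s.leftIdeal i →ₗ[A] s.leftIdeal j) :
    s.IsPeirce i j (f (s.gen i)) :=
  ⟨by rw [← smul_eq_mul, ← Submodule.coe_smul, ← map_smul, e_smul_gen],
    s.mem_leftIdeal.mp (f (s.gen i)).2⟩

/-- Evaluation at the generator identifies maps `A e_i → A e_j` with Peirce elements, and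
composition with multiplication. On one-dimensional components, one vanishing product of nonzero
elements kills every composite. -/
theorem isIncidenceLike_of_projectiveHomCondition (h : ProjectiveHomCondition K A) :
    s.IsIncidenceLike := by
  have h1 : ∀ i j x y, s.IsPeirce i j x → s.IsPeirce i j y → x ≠ 0 → ∃ c : K, y = c • x := by
    intro i j x y hx hy hx0
    have hrank := h.1 (s.leftIdeal i) (s.leftIdeal j) inferInstance
      (s.isIndecomposableModule_leftIdeal i) inferInstance (s.isIndecomposableModule_leftIdeal j)
    obtain ⟨f, hf⟩ := rank_le_one_iff.mp hrank
    obtain ⟨r, hr⟩ := hf (s.rightMul hx)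
    obtain ⟨t, ht⟩ := hf (s.rightMul hy)
    have hr' : r • (f (s.gen i) : A) = x := by
      rw [← coe_rightMul_gen hx, ← hr]; rfl
    have ht' : t • (f (s.gen i) : A) = y := by
      rw [← coe_rightMul_gen hy, ← ht]; rfl
    have hr0 : r ≠ 0 := by
      rintro rfl
      exact hx0 (by rw [← hr', zero_smul])
    exact ⟨t * r⁻¹, by rw [← ht', ← hr', mul_smul, inv_smul_smul₀ hr0]⟩
  refine ⟨h1, fun i j k x y hx hy hx0 hy0 hxy => ?_⟩
  obtain ⟨f, g, hfg⟩ := h.2 (s.leftIdeal i) (s.leftIdeal j) (s.leftIdeal k) inferInstance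
    (s.isIndecomposableModule_leftIdeal i) inferInstance (s.isIndecomposableModule_leftIdeal j)
    inferInstance (s.isIndecomposableModule_leftIdeal k) ⟨_, rightMul_ne_zero hx hx0⟩
    ⟨_, rightMul_ne_zero hy hy0⟩
  apply hfg
  obtain ⟨c, hc⟩ := h1 i j x _ hx (isPeirce_map_gen f) hx0
  obtain ⟨d, hd⟩ := h1 j k y _ hy (isPeirce_map_gen g) hy0
  have h2 : g (f (s.gen i)) = 0 := by
    apply Subtype.ext
    rw [← s.coe_smul_gen (f (s.gen i)), map_smul, Submodule.coe_smul, hc, hd, smul_eq_mul,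
      smul_mul_smul_comm, hxy, smul_zero]
    rfl
  refine LinearMap.ext fun z => ?_
  rw [← s.coe_smul_gen z, map_smul, LinearMap.comp_apply, h2, smul_zero, LinearMap.zero_apply]

end

section

variable {K : Type u} {A : Type v} {ι : Type*} [Field K] [Ring A] [Algebra K A] [Fintype ι]
  {s : PointedSystem K A ι} (hs : s.IsIncidenceLike)
include hs

theorem IsIncidenceLike.projectiveHomCondition [IsArtinianRing A] :
    ProjectiveHomCondition K A := by
  constructor
  · intro P Q _ _ _ _ _ _ _ _ hP hP' hQ hQ'
    obtain ⟨i, ⟨φ⟩⟩ := s.exists_leftIdeal_equiv P hP'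
    obtain ⟨j, ⟨ψ⟩⟩ := s.exists_leftIdeal_equiv Q hQ'
    let F (f : P →ₗ[A] Q) : s.leftIdeal i →ₗ[A] s.leftIdeal j := ψ.symm ∘ₗ f ∘ₗ φ
    have hF (f : P →ₗ[A] Q) (z : s.leftIdeal i) : f (φ z) = (z : A) • ψ (F f (s.gen i)) := by
      rw [← map_smul, ← map_smul, coe_smul_gen]
      simp [F]
    have hφ (f g : P →ₗ[A] Q) (h : ∀ z, f (φ z) = g (φ z)) : f = g :=
      LinearMap.ext fun p => by simpa using h (φ.symm p)
    rw [rank_le_one_iff]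
    by_cases hzero : ∀ f : P →ₗ[A] Q, f = 0
    · exact ⟨0, fun f => ⟨0, by rw [hzero f, smul_zero]⟩⟩
    · push Not at hzero
      obtain ⟨f, hf⟩ := hzero
      refine ⟨f, fun g => ?_⟩
      have hne : (F f (s.gen i) : A) ≠ 0 := by
        intro h
        have h' : F f (s.gen i) = 0 := Subtype.ext h
        exact hf (hφ _ _ fun z => by rw [hF, h']; simp)
      obtain ⟨c, hc⟩ := hs.1 i j _ _ (isPeirce_map_gen (F f)) (isPeirce_map_gen (F g)) hne
      have hc' : F g (s.gen i) = c • F f (s.gen i) := Subtype.ext hc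
      refine ⟨c, hφ _ _ fun z => ?_⟩
      rw [LinearMap.smul_apply, hF, hF, hc', ← algebraMap_smul A c (F f (s.gen i)), map_smul,
        algebraMap_smul, smul_comm]
  · rintro P Q R _ _ _ _ _ _ hP hP' hQ hQ' hR hR' ⟨f, hf⟩ ⟨g, hg⟩
    obtain ⟨i, ⟨φ⟩⟩ := s.exists_leftIdeal_equiv P hP'
    obtain ⟨j, ⟨ψ⟩⟩ := s.exists_leftIdeal_equiv Q hQ'
    obtain ⟨k, ⟨θ⟩⟩ := s.exists_leftIdeal_equiv R hR'
    let F : s.leftIdeal i →ₗ[A] s.leftIdeal j := ψ.symm ∘ₗ f ∘ₗ φ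
    let G : s.leftIdeal j →ₗ[A] s.leftIdeal k := θ.symm ∘ₗ g ∘ₗ ψ
    have hF (z : s.leftIdeal i) : F z = (z : A) • F (s.gen i) := by
      rw [← map_smul, coe_smul_gen]
    have hG (z : s.leftIdeal j) : G z = (z : A) • G (s.gen j) := by
      rw [← map_smul, coe_smul_gen]
    have hF0 : (F (s.gen i) : A) ≠ 0 := by
      intro h
      have h' : F (s.gen i) = 0 := Subtype.ext h
      refine hf (LinearMap.ext fun p => ?_)
      have : F (φ.symm p) = 0 := by rw [hF, h', smul_zero]
      simpa [F] using this
    have hG0 : (G (s.gen j) : A) ≠ 0 := by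
      intro h
      have h' : G (s.gen j) = 0 := Subtype.ext h
      refine hg (LinearMap.ext fun p => ?_)
      have : G (ψ.symm p) = 0 := by rw [hG, h', smul_zero]
      simpa [G] using this
    refine ⟨f, g, fun h => ?_⟩
    refine hs.2 i j k _ _ (isPeirce_map_gen F) (isPeirce_map_gen G) hF0 hG0 ?_
    rw [← smul_eq_mul, ← Submodule.coe_smul, ← hG]
    have := LinearMap.congr_fun h (φ (s.gen i))
    simpa [F, G] using this

/-- As `1` is the sum of the `e i`, a local submodule is generated by some `m = e i • m`. The
surjection from `A e_i` is injective because products of nonzero Peirce elements do not vanish. -/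
theorem IsIncidenceLike.isLocallyHereditary [IsArtinianRing A] : IsLocallyHereditary A := by
  intro P _ _ hP hP' N ⟨M, hM, hmax⟩
  obtain ⟨k, ⟨φ⟩⟩ := s.exists_leftIdeal_equiv P hP'
  obtain ⟨i, m, hm, hmM⟩ : ∃ i, ∃ m : N, s.e i • m = m ∧ m ∉ M := by
    by_contra! hcon
    apply hM
    rw [eq_top_iff]
    intro m _
    rw [← one_smul A m, ← s.sum_e, Finset.sum_smul]
    exact M.sum_mem fun i _ => hcon i _ (by rw [← mul_smul, e_mul_e])
  have htop : Submodule.span A {m} = ⊤ := by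
    by_contra hne
    exact hmM (hmax _ hne (Submodule.mem_span_singleton_self m))
  let f : s.leftIdeal i →ₗ[A] N :=
    LinearMap.toSpanSingleton A N m ∘ₗ (s.leftIdeal i).subtype
  have hsurj : Function.Surjective f := by
    intro z
    obtain ⟨a, rfl⟩ := Submodule.mem_span_singleton.mp (htop ▸ trivial : z ∈ Submodule.span A {m})
    refine ⟨a • s.gen i, ?_⟩
    change (a * s.e i) • m = a • m
    rw [mul_smul, hm]
  have hm0 : m ≠ 0 := fun h => hmM (h ▸ M.zero_mem)
  set x : A := ((φ.symm (m : P) : s.leftIdeal k) : A) with hx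
  have hxP : s.IsPeirce i k x := by
    refine ⟨?_, s.mem_leftIdeal.mp (φ.symm (m : P)).2⟩
    rw [hx, ← smul_eq_mul, ← Submodule.coe_smul, ← map_smul, ← Submodule.coe_smul, hm]
  have hx0 : x ≠ 0 := by
    intro h
    apply hm0
    apply Subtype.ext
    have h' : φ.symm (m : P) = 0 := Subtype.ext h
    simpa using h'
  have hinj : Function.Injective f := by
    rw [injective_iff_map_eq_zero]
    intro z hz
    by_contra hz0
    obtain ⟨j, hj⟩ := s.exists_e_mul_ne_zero hz0
    have hzP : s.IsPeirce j i (s.e j * z) :=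
      ⟨by rw [← mul_assoc, e_mul_e], by rw [mul_assoc, s.mem_leftIdeal.mp z.2]⟩
    refine hs.2 j i k _ x hzP hxP (fun h => hj (Subtype.ext h)) hx0 ?_
    have h1 : (z : A) • (m : P) = 0 := congrArg Subtype.val hz
    have h2 : (z : A) * x = 0 := by
      rw [hx, ← smul_eq_mul, ← Submodule.coe_smul, ← map_smul, h1, map_zero]
      rfl
    rw [mul_assoc, h2, mul_zero]
  exact Module.Projective.of_equiv (LinearEquiv.ofBijective f ⟨hinj, hsurj⟩)

/-- Each `e i * A * e k` is at most a line, so `e i • x` lies in every submodule having a nonzero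
`i`-th component. -/
theorem IsIncidenceLike.isDistributiveModule_leftIdeal (k : ι) :
    IsDistributiveModule A (s.leftIdeal k) := by
  intro X Y Z
  refine le_antisymm ?_ le_inf_sup
  rintro x ⟨hxX, hxYZ⟩
  obtain ⟨y, hy, z, hz, hyz⟩ := Submodule.mem_sup.mp hxYZ
  rw [← one_smul A x, ← s.sum_e, Finset.sum_smul]
  refine Submodule.sum_mem _ fun i _ => ?_
  have hP (w : s.leftIdeal k) : s.IsPeirce i k (s.e i • w : s.leftIdeal k) :=
    ⟨by rw [Submodule.coe_smul, smul_eq_mul, ← mul_assoc, e_mul_e],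
      s.mem_leftIdeal.mp (s.e i • w).2⟩
  have key (W : Submodule A (s.leftIdeal k)) (w) (hw : w ∈ W) (h0 : s.e i • w ≠ 0) :
      s.e i • x ∈ W := by
    obtain ⟨c, hc⟩ := hs.1 i k _ _ (hP w) (hP x) (fun h => h0 (Subtype.ext h))
    have hc' : s.e i • x = c • s.e i • w := Subtype.ext hc
    rw [hc', ← algebraMap_smul A]
    exact W.smul_mem _ (W.smul_mem _ hw)
  by_cases h1 : s.e i • y = 0
  · by_cases h2 : s.e i • z = 0
    · rw [← hyz, smul_add, h1, h2, add_zero]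
      exact Submodule.zero_mem _
    · exact Submodule.mem_sup_right ⟨X.smul_mem _ hxX, key Z z hz h2⟩
  · exact Submodule.mem_sup_left ⟨X.smul_mem _ hxX, key Y y hy h1⟩

/-- An ideal is determined by the pairs `(i, j)` at which its Peirce component is nonzero. -/
theorem IsIncidenceLike.finite_twoSidedIdeal : Finite (TwoSidedIdeal A) := by
  let F (I : TwoSidedIdeal A) : Set (ι × ι) := {p | ∃ x ∈ I, s.IsPeirce p.1 p.2 x ∧ x ≠ 0}
  have hle (I J : TwoSidedIdeal A) (h : F I ≤ F J) (a : A) (ha : a ∈ I) : a ∈ J := by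
    rw [← s.sum_sum_eq a]
    refine sum_mem fun i _ => sum_mem fun j _ => ?_
    by_cases h0 : s.e i * a * s.e j = 0
    · rw [h0]
      exact J.zero_mem
    · obtain ⟨x, hxJ, hx, hx0⟩ := @h (i, j) ⟨s.e i * a * s.e j,
        I.mul_mem_right _ _ (I.mul_mem_left _ _ ha), s.isPeirce_mul_mul i j a, h0⟩
      obtain ⟨c, hc⟩ := hs.1 i j _ _ hx (s.isPeirce_mul_mul i j a) hx0
      rw [hc, Algebra.smul_def]
      exact J.mul_mem_left _ _ hxJ
  exact Finite.of_injective F fun I J h => TwoSidedIdeal.ext fun a =>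
    ⟨hle I J h.le a, hle J I h.ge a⟩

end

theorem IsIncidenceLike.isSemidistributiveRing {K : Type*} {A : Type v} {ι : Type} [Field K]
    [Ring A] [Algebra K A] [Fintype ι] {s : PointedSystem K A ι} (hs : s.IsIncidenceLike) :
    IsSemidistributiveRing A := by
  -- The lift puts the index type in the universe of `A`, as semidistributivity requires.
  refine ⟨ULift ι, fun i => s.leftIdeal i.down, ?_, ?_,
    fun i => hs.isDistributiveModule_leftIdeal i.down⟩
  · rw [iSupIndep_def]
    intro i
    rw [Submodule.disjoint_def]
    intro x hx hx'
    have hle : ⨆ j, ⨆ _ : j ≠ i, s.leftIdeal (j : ULift ι).down ≤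
        LinearMap.ker (LinearMap.toSpanSingleton A A (s.e i.down)) := by
      refine iSup₂_le fun j hj y hy => ?_
      change y * s.e i.down = 0
      rw [← s.mem_leftIdeal.mp hy, mul_assoc,
        s.e_mul_e_of_ne fun h => hj (ULift.down_injective h), mul_zero]
    have h0 : x * s.e i.down = 0 := hle hx'
    rw [← s.mem_leftIdeal.mp hx, h0]
  · rw [eq_top_iff]
    intro a _
    rw [← mul_one a, ← s.sum_e, Finset.mul_sum]
    refine Submodule.sum_mem _ fun i _ => Submodule.mem_iSup_of_mem (ULift.up i) ?_
    rw [mem_leftIdeal, mul_assoc, e_mul_e]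

end PointedSystem

/-! ### Computation in deformed incidence algebras -/

namespace DeformedIncidenceAlgebra

variable {K : Type*} {P : Type*} [Field K] [PartialOrder P] {lam : P → P → P → Kˣ}

theorem ext {f g : DeformedIncidenceAlgebra K P lam} (h : ∀ x y, x ≤ y → f x y = g x y) : f = g :=
  IncidenceAlgebra.ext h

theorem smul_apply (c : K) (f : DeformedIncidenceAlgebra K P lam) (x y : P) :
    (c • f) x y = c * f x y := rfl

theorem zero_apply (x y : P) : (0 : DeformedIncidenceAlgebra K P lam) x y = 0 := rfl

theorem apply_eq_zero (f : DeformedIncidenceAlgebra K P lam) {x y : P} (h : ¬x ≤ y) : f x y = 0 :=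
  IncidenceAlgebra.apply_eq_zero_of_not_le h f

/-- The evaluation of an element at a pair, as a linear functional. -/
def eval (x y : P) : DeformedIncidenceAlgebra K P lam →ₗ[K] K where
  toFun f := f x y
  map_add' _ _ := rfl
  map_smul' _ _ := rfl

theorem eval_apply (x y : P) (f : DeformedIncidenceAlgebra K P lam) : eval x y f = f x y := rfl

open Classical in
/-- The multiple `c • f_{xy}` of a basis element, and zero unless `x ≤ y`. -/
noncomputable def single (lam : P → P → P → Kˣ) (x y : P) (c : K) : DeformedIncidenceAlgebra K P lam :=
  (⟨fun u v => if u = x ∧ v = y ∧ x ≤ y then c else 0, fun u v h => if_neg (by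
    rintro ⟨rfl, rfl, h'⟩
    exact h h')⟩ : IncidenceAlgebra K P)

open Classical in
theorem single_apply (x y u v : P) (c : K) :
    single lam x y c u v =
      if u = x ∧ v = y ∧ x ≤ y then c else 0 := rfl

theorem single_apply_self {x y : P} (h : x ≤ y) (c : K) :
    single lam x y c x y = c := by
  rw [single_apply, if_pos ⟨rfl, rfl, h⟩]

theorem single_apply_of_ne_left {x y u v : P} (h : u ≠ x) (c : K) :
    single lam x y c u v = 0 := by
  rw [single_apply, if_neg fun h' => h h'.1]

theorem single_apply_of_ne_right {x y u v : P} (h : v ≠ y) (c : K) :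
    single lam x y c u v = 0 := by
  rw [single_apply, if_neg fun h' => h h'.2.1]

variable [LocallyFiniteOrder P]

theorem mul_single_apply (f : DeformedIncidenceAlgebra K P lam) {x y z : P} (hyz : y ≤ z) (c : K) :
    (f * single lam y z c) x z = lam x y z * (f x y * c) := by
  rw [mul_apply]
  by_cases hxy : x ≤ y
  · rw [Finset.sum_eq_single_of_mem y (Finset.mem_Icc.mpr ⟨hxy, hyz⟩), single_apply_self hyz]
    intro w _ hw
    rw [single_apply_of_ne_left hw, mul_zero, mul_zero]
  · rw [apply_eq_zero f hxy, zero_mul, mul_zero]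
    refine Finset.sum_eq_zero fun w hw => ?_
    rw [single_apply_of_ne_left, mul_zero, mul_zero]
    rintro rfl
    exact hxy (Finset.mem_Icc.mp hw).1

theorem single_mul_apply (f : DeformedIncidenceAlgebra K P lam) {x y z : P} (hxy : x ≤ y) (c : K) :
    (single lam x y c * f) x z = lam x y z * (c * f y z) := by
  rw [mul_apply]
  by_cases hyz : y ≤ z
  · rw [Finset.sum_eq_single_of_mem y (Finset.mem_Icc.mpr ⟨hxy, hyz⟩), single_apply_self hxy]
    intro w _ hw
    rw [single_apply_of_ne_right hw, zero_mul, mul_zero]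
  · rw [apply_eq_zero f hyz, mul_zero, mul_zero]
    refine Finset.sum_eq_zero fun w hw => ?_
    rw [single_apply_of_ne_right, zero_mul, mul_zero]
    rintro rfl
    exact hyz (Finset.mem_Icc.mp hw).2

theorem single_mul_apply_of_ne (f : DeformedIncidenceAlgebra K P lam) {x y u v : P} (h : u ≠ x)
    (c : K) : (single lam x y c * f) u v = 0 := by
  rw [mul_apply]
  exact Finset.sum_eq_zero fun w _ => by rw [single_apply_of_ne_left h, zero_mul, mul_zero]

theorem mul_single_apply_of_ne (f : DeformedIncidenceAlgebra K P lam) {x y u v : P} (h : v ≠ y)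
    (c : K) : (f * single lam x y c) u v = 0 := by
  rw [mul_apply]
  exact Finset.sum_eq_zero fun w _ => by rw [single_apply_of_ne_right h, mul_zero, mul_zero]

section Identity

variable {u : DeformedIncidenceAlgebra K P lam} (h1 : ∀ f, u * f = f) (h2 : ∀ f, f * u = f)

include h1 in
-- The deformation is not normalized: the identity is diagonal, but its entries are the inverses of
-- `lam x x z`, which therefore cannot depend on `z`.
theorem lam_left_of_one_mul {x z : P} (h : x ≤ z) : (lam x x z : K) * u x x = 1 := by
  have := congrArg (fun f => (f : DeformedIncidenceAlgebra K P lam) x z) (h1 (single lam x z 1))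
  simpa [mul_single_apply _ h, single_apply_self h] using this

include h2 in
theorem lam_right_of_mul_one {x z : P} (h : x ≤ z) : (lam x z z : K) * u z z = 1 := by
  have := congrArg (fun f => (f : DeformedIncidenceAlgebra K P lam) x z) (h2 (single lam x z 1))
  simpa [single_mul_apply _ h, single_apply_self h] using this

include h1 in
theorem one_apply_of_ne {x y : P} (h : x ≠ y) : u x y = 0 := by
  have := congrArg (fun f => (f : DeformedIncidenceAlgebra K P lam) x y) (h1 (single lam y y 1))
  simpa [mul_single_apply _ le_rfl, single_apply_of_ne_left h] using this

include h1 in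
theorem single_one_mul_apply (f : DeformedIncidenceAlgebra K P lam) (x z : P) :
    (single lam x x (u x x) * f) x z = f x z := by
  rw [single_mul_apply f le_rfl]
  by_cases h : x ≤ z
  · rw [← mul_assoc, lam_left_of_one_mul h1 h, one_mul]
  · rw [apply_eq_zero f h, mul_zero, mul_zero]

include h2 in
theorem mul_single_one_apply (f : DeformedIncidenceAlgebra K P lam) (x z : P) :
    (f * single lam z z (u z z)) x z = f x z := by
  rw [mul_single_apply f le_rfl]
  by_cases h : x ≤ z
  · rw [mul_left_comm, lam_right_of_mul_one h2 h, mul_one]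
  · rw [apply_eq_zero f h, zero_mul, mul_zero]

end Identity

end DeformedIncidenceAlgebra

open DeformedIncidenceAlgebra in
theorem IsDeformedIncidenceAlgebra.exists_isIncidenceLike {K : Type u} {A : Type v} [Field K]
    [Ring A] [Algebra K A] [FiniteDimensional K A] (hA : IsBasicPointed K A)
    (h : IsDeformedIncidenceAlgebra K A) :
    ∃ (P : Type) (_ : Fintype P) (s : PointedSystem K A P), s.IsIncidenceLike := by
  classical
  obtain ⟨P, _, _, _, lam, φ, hφ⟩ := h
  have hinj {a b : A} (hab : ∀ x y, φ a x y = φ b x y) : a = b :=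
    φ.injective (ext fun x y _ => hab x y)
  have h1 f : φ 1 * f = f := by
    obtain ⟨a, rfl⟩ := φ.surjective f
    rw [← hφ, one_mul]
  have h2 f : f * φ 1 = f := by
    obtain ⟨a, rfl⟩ := φ.surjective f
    rw [← hφ, mul_one]
  let e (x : P) : A := φ.symm (single lam x x (φ 1 x x))
  have he (x : P) : φ (e x) = single lam x x (φ 1 x x) := φ.apply_symm_apply _
  have hee (x y z : P) : φ (e x) y z = if y = x ∧ z = x then φ 1 x x else 0 := by
    rw [he, single_apply]
    simp
  have hea (x : P) (a : A) (y z : P) : φ (e x * a) y z = if y = x then φ a y z else 0 := by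
    rw [hφ, he]
    split_ifs with hyx
    · rw [hyx, single_one_mul_apply h1]
    · exact single_mul_apply_of_ne _ hyx _
  have hae (x : P) (a : A) (y z : P) : φ (a * e x) y z = if z = x then φ a y z else 0 := by
    rw [hφ, he]
    split_ifs with hzx
    · rw [hzx, mul_single_one_apply h2]
    · exact mul_single_apply_of_ne _ hzx _
  have hcomplete : CompleteOrthogonalIdempotents e :=
    { idem := fun x => hinj fun y z => by
        rw [hea, hee]
        by_cases h : y = x <;> simp [h]
      ortho := fun x x' hx => hinj fun y z => by
        rw [hea, hee, map_zero, DeformedIncidenceAlgebra.zero_apply]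
        by_cases h : y = x <;> simp [h, hx]
      complete := hinj fun y z => by
        rw [← eval_apply, map_sum, map_sum]
        simp only [eval_apply, hee]
        by_cases hyz : y = z
        · subst hyz
          simp
        · rw [one_apply_of_ne h1 hyz]
          exact Finset.sum_eq_zero fun x _ => if_neg (by rintro ⟨rfl, rfl⟩; exact hyz rfl) }
  have hlam (x : P) : (lam x x x : K) * φ 1 x x = 1 := lam_left_of_one_mul h1 le_rfl
  -- Diagonal entries multiply with an extra factor `lam x x x`; rescaling by it makes the
  -- evaluation multiplicative and unital.
  let χ (x : P) : A →ₐ[K] K := AlgHom.ofLinearMap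
    ((lam x x x : K) • eval x x ∘ₗ (φ : A →ₗ[K] DeformedIncidenceAlgebra K P lam))
    (hlam x) (fun a b => by
      change (lam x x x : K) * φ (a * b) x x = lam x x x * φ a x x * (lam x x x * φ b x x)
      rw [hφ, mul_apply, Finset.Icc_self, Finset.sum_singleton]
      ring)
  have hχ (x : P) (a : A) : χ x a = lam x x x * φ a x x := rfl
  let s : PointedSystem K A P :=
    { e := e
      χ := χ
      complete := hcomplete
      χ_self := fun x => by rw [hχ, hee, if_pos ⟨rfl, rfl⟩, hlam]
      isNilpotent := fun a ha => hA.isNilpotent fun ψ => by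
        -- Any character `ψ` is nonzero on some `e x`, so `e x * a * e x = 0` forces `ψ a = 0`.
        obtain ⟨x, hx⟩ : ∃ x, ψ (e x) ≠ 0 := by
          by_contra! h0
          have := congrArg ψ hcomplete.complete
          simp [h0] at this
        have hxax : e x * a * e x = 0 := hinj fun y z => by
          have hax : φ a x x = 0 := by simpa [hχ] using ha x
          rw [hae, hea, map_zero, DeformedIncidenceAlgebra.zero_apply]
          split_ifs with h3 h4
          · rw [h3, h4, hax]
          · rfl
          · rfl
        have := congrArg ψ hxax
        simpa [hx] using this }
  have hP {x y : P} {a : A} (ha : s.IsPeirce x y a) {u v : P} (huv : ¬(u = x ∧ v = y)) :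
      φ a u v = 0 := by
    by_cases hu : u = x
    · have hv : v ≠ y := fun hv => huv ⟨hu, hv⟩
      rw [← ha.2]
      exact (hae y a u v).trans (if_neg hv)
    · rw [← ha.1]
      exact (hea x a u v).trans (if_neg hu)
  have hne {x y : P} {a : A} (ha : s.IsPeirce x y a) (h0 : a ≠ 0) : φ a x y ≠ 0 := by
    refine fun h3 => h0 (hinj fun u v => ?_)
    rw [map_zero, DeformedIncidenceAlgebra.zero_apply]
    by_cases huv : u = x ∧ v = y
    · rw [huv.1, huv.2, h3]
    · exact hP ha huv
  refine ⟨P, inferInstance, s, fun x y a b ha hb h0 => ⟨φ b x y / φ a x y, hinj fun u v => ?_⟩,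
    fun x y z a b ha hb ha0 hb0 hab => ?_⟩
  · rw [map_smul, DeformedIncidenceAlgebra.smul_apply]
    by_cases huv : u = x ∧ v = y
    · rw [huv.1, huv.2, div_mul_cancel₀ _ (hne ha h0)]
    · rw [hP ha huv, hP hb huv, mul_zero]
  · have hxy : x ≤ y := by
      by_contra h3
      exact hne ha ha0 (apply_eq_zero _ h3)
    have hyz : y ≤ z := by
      by_contra h3
      exact hne hb hb0 (apply_eq_zero _ h3)
    have h3 : φ (a * b) x z = lam x y z * (φ a x y * φ b y z) := by
      rw [hφ, mul_apply, Finset.sum_eq_single_of_mem y (Finset.mem_Icc.mpr ⟨hxy, hyz⟩)]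
      intro w _ hw
      rw [hP ha fun h => hw h.2, zero_mul, mul_zero]
    rw [hab, map_zero, DeformedIncidenceAlgebra.zero_apply] at h3
    exact mul_ne_zero (Units.ne_zero _) (mul_ne_zero (hne ha ha0) (hne hb hb0)) h3.symm

/-! ### Recovering the poset and the deformation -/

namespace PointedSystem

variable {K : Type*} {A : Type*} {ι : Type*} [Field K] [Ring A] [Algebra K A] [Fintype ι]
  {s : PointedSystem K A ι}

/-- If `i ≠ j`, then `x * y` is a multiple of `e i` killed by `χ i`, hence zero, against the
nonvanishing of products. -/
theorem IsIncidenceLike.eq_of_isPeirce (hs : s.IsIncidenceLike) {i j : ι} {x y : A}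
    (hx : s.IsPeirce i j x) (hy : s.IsPeirce j i y) (hx0 : x ≠ 0) (hy0 : y ≠ 0) : i = j := by
  by_contra hij
  obtain ⟨c, hc⟩ := hs.1 i i _ _ (s.isPeirce_e i) (hx.mul hy) (s.e_ne_zero i)
  have hne := hs.2 i j i x y hx hy hx0 hy0
  have h0 : s.χ i (x * y) = 0 := by rw [map_mul, hx.χ_right hij, zero_mul]
  rw [hc, map_smul, s.χ_self, smul_eq_mul, mul_one] at h0
  exact hne (by rw [hc, h0, zero_smul])

/-- The order on the index set given by the nonzero Peirce components. -/
abbrev IsIncidenceLike.partialOrder (hs : s.IsIncidenceLike) : PartialOrder ι where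
  le i j := ∃ x, s.IsPeirce i j x ∧ x ≠ 0
  le_refl i := ⟨s.e i, s.isPeirce_e i, s.e_ne_zero i⟩
  le_trans i j k := fun ⟨x, hx, hx0⟩ ⟨y, hy, hy0⟩ =>
    ⟨x * y, hx.mul hy, hs.2 i j k x y hx hy hx0 hy0⟩
  le_antisymm _ _ := fun ⟨_, hx, hx0⟩ ⟨_, hy, hy0⟩ => hs.eq_of_isPeirce hx hy hx0 hy0

end PointedSystem

open DeformedIncidenceAlgebra in
theorem PointedSystem.IsIncidenceLike.isDeformedIncidenceAlgebra {K : Type u} {A : Type v}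
    {ι : Type} [Field K] [Ring A] [Algebra K A] [Fintype ι] {s : PointedSystem K A ι}
    (hs : s.IsIncidenceLike) : IsDeformedIncidenceAlgebra K A := by
  classical
  let po := hs.partialOrder
  let lf : LocallyFiniteOrder ι := Fintype.toLocallyFiniteOrder
  have hle {i j : ι} : i ≤ j ↔ ∃ x, s.IsPeirce i j x ∧ x ≠ 0 := Iff.rfl
  have hex (i j : ι) : ∃ x, s.IsPeirce i j x ∧ (i ≤ j → x ≠ 0) := by
    by_cases h : i ≤ j
    · obtain ⟨x, hx, hx0⟩ := hle.mp h
      exact ⟨x, hx, fun _ => hx0⟩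
    · exact ⟨0, ⟨mul_zero _, zero_mul _⟩, fun h' => absurd h' h⟩
  choose f hf hf0 using hex
  have hlamex (i j k : ι) : ∃ l : Kˣ, i ≤ j → j ≤ k → f i j * f j k = (l : K) • f i k := by
    by_cases h : i ≤ j ∧ j ≤ k
    · obtain ⟨c, hc⟩ := hs.1 i k _ _ (hf i k) ((hf i j).mul (hf j k)) (hf0 i k (h.1.trans h.2))
      have hc0 : c ≠ 0 := by
        rintro rfl
        exact hs.2 i j k _ _ (hf i j) (hf j k) (hf0 i j h.1) (hf0 j k h.2) (by rw [hc, zero_smul])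
      exact ⟨Units.mk0 c hc0, fun _ _ => hc⟩
    · exact ⟨1, fun h1 h2 => absurd ⟨h1, h2⟩ h⟩
  choose lam hlam using hlamex
  let Φ : DeformedIncidenceAlgebra K ι lam →ₗ[K] A :=
    ∑ i, ∑ j, (eval i j).smulRight (f i j)
  have hΦ (g : DeformedIncidenceAlgebra K ι lam) : Φ g = ∑ i, ∑ j, g i j • f i j := by
    simp [Φ, eval_apply]
  -- Peirce components of `Φ g` read off the coefficients of `g`; injectivity and multiplicativity
  -- are both checked componentwise through this.
  have hcomp (g : DeformedIncidenceAlgebra K ι lam) (i j : ι) :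
      s.e i * Φ g * s.e j = g i j • f i j := by
    rw [hΦ, Finset.mul_sum, Finset.sum_mul, Finset.sum_eq_single_of_mem i (Finset.mem_univ i),
      Finset.mul_sum, Finset.sum_mul, Finset.sum_eq_single_of_mem j (Finset.mem_univ j),
      mul_smul_comm, smul_mul_assoc, (hf i j).1, (hf i j).2]
    · intro j' _ hj
      rw [mul_smul_comm, smul_mul_assoc, (hf i j').1, (hf i j').mul_eq_zero (s.isPeirce_e j) hj,
        smul_zero]
    · intro i' _ hi
      rw [Finset.mul_sum, Finset.sum_mul]
      refine Finset.sum_eq_zero fun j' _ => ?_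
      rw [mul_smul_comm, (s.isPeirce_e i).mul_eq_zero (hf i' j') hi.symm, smul_zero, zero_mul]
  have hbij : Function.Bijective Φ := by
    constructor
    · rw [injective_iff_map_eq_zero]
      refine fun g hg => ext fun i j hij => ?_
      have := hcomp g i j
      rw [hg, mul_zero, zero_mul] at this
      exact (smul_eq_zero.mp this.symm).resolve_right (hf0 i j hij)
    · intro a
      have hco (i j : ι) : ∃ c : K, s.e i * a * s.e j = c • f i j ∧ (¬i ≤ j → c = 0) := by
        by_cases h : i ≤ j
        · obtain ⟨c, hc⟩ := hs.1 i j _ _ (hf i j) (s.isPeirce_mul_mul i j a) (hf0 i j h)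
          exact ⟨c, hc, fun h' => absurd h h'⟩
        · refine ⟨0, ?_, fun _ => rfl⟩
          by_contra h0
          rw [zero_smul] at h0
          exact h ⟨_, s.isPeirce_mul_mul i j a, h0⟩
      choose c hc hc0 using hco
      let g : DeformedIncidenceAlgebra K ι lam :=
        (⟨c, fun i j h => hc0 i j h⟩ : IncidenceAlgebra K ι)
      refine ⟨g, ?_⟩
      rw [hΦ, ← s.sum_sum_eq a]
      exact Finset.sum_congr rfl fun i _ => Finset.sum_congr rfl fun j _ => (hc i j).symm
  have hmul (g h : DeformedIncidenceAlgebra K ι lam) : Φ (g * h) = Φ g * Φ h := by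
    rw [← s.sum_sum_eq (Φ g * Φ h), ← s.sum_sum_eq (Φ (g * h))]
    refine Finset.sum_congr rfl fun i _ => Finset.sum_congr rfl fun k _ => ?_
    -- Inserting `1 = ∑ j, e j` between the factors produces the convolution sum; the terms outside
    -- the interval from `i` to `k` vanish.
    have h1 : s.e i * (Φ g * Φ h) * s.e k =
        ∑ j, (s.e i * Φ g * s.e j) * (s.e j * Φ h * s.e k) := by
      rw [← mul_one (Φ g), ← s.sum_e, Finset.mul_sum, Finset.sum_mul, Finset.mul_sum,
        Finset.sum_mul]
      refine Finset.sum_congr rfl fun j _ => ?_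
      rw [← Finset.mul_sum, s.sum_e, mul_one]
      conv_lhs => rw [← s.e_mul_e j]
      simp only [mul_assoc]
    rw [h1, hcomp, mul_apply, Finset.sum_smul, eq_comm, ← Finset.sum_subset (Finset.subset_univ _)]
    · refine Finset.sum_congr rfl fun j hj => ?_
      obtain ⟨hij, hjk⟩ := Finset.mem_Icc.mp hj
      rw [hcomp, hcomp, smul_mul_smul_comm, hlam i j k hij hjk, smul_smul, mul_comm]
    · intro j _ hj
      rw [hcomp, hcomp]
      by_cases hij : i ≤ j
      · rw [apply_eq_zero h fun hjk => hj (Finset.mem_Icc.mpr ⟨hij, hjk⟩), zero_smul, mul_zero]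
      · rw [apply_eq_zero g hij, zero_smul, zero_mul]
  let E := LinearEquiv.ofBijective Φ hbij
  refine ⟨ι, inferInstance, po, lf, lam, E.symm, fun a b => E.injective ?_⟩
  rw [E.apply_symm_apply]
  change a * b = Φ (E.symm a * E.symm b)
  rw [hmul]
  change a * b = E (E.symm a) * E (E.symm b)
  rw [E.apply_symm_apply, E.apply_symm_apply]

theorem theorem4p9 (K : Type u) (A : Type v) [Field K] [Infinite K] [Ring A] [Algebra K A]
    [FiniteDimensional K A] (hA : IsBasicPointed K A) :
    List.TFAE
      [IsDeformedIncidenceAlgebra K A,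
        IsLocallyHereditary A ∧ IsSemidistributiveRing A,
        IsLocallyHereditary Aᵐᵒᵖ ∧ IsSemidistributiveRing Aᵐᵒᵖ,
        Finite (TwoSidedIdeal A) ∧ (IsLocallyHereditary A ∨ IsLocallyHereditary Aᵐᵒᵖ),
        ProjectiveHomCondition K A] := by
  have : IsArtinianRing A := IsArtinianRing.of_finite K A
  have : IsArtinianRing Aᵐᵒᵖ := IsArtinianRing.of_finite K Aᵐᵒᵖ
  obtain ⟨n, ⟨t⟩⟩ := hA.exists_pointedSystem
  -- Here the system is indexed by the poset itself; the other implications use `t`, since the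
  -- hypotheses do not mention idempotents.
  tfae_have 1 → 2 := fun h => by
    obtain ⟨P, _, s, hs⟩ := h.exists_isIncidenceLike hA
    exact ⟨hs.isLocallyHereditary, hs.isSemidistributiveRing⟩
  tfae_have 2 → 3 := fun h => by
    have ht : t.IsIncidenceLike := PointedSystem.isIncidenceLike_of_isSemidistributiveRing h.1 h.2
    have ht' := PointedSystem.isIncidenceLike_op.mpr ht
    exact ⟨ht'.isLocallyHereditary, ht'.isSemidistributiveRing⟩
  tfae_have 3 → 4 := fun h => by
    have ht : t.op.IsIncidenceLike :=
      PointedSystem.isIncidenceLike_of_isSemidistributiveRing h.1 h.2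
    exact ⟨(PointedSystem.isIncidenceLike_op.mp ht).finite_twoSidedIdeal, Or.inr h.1⟩
  tfae_have 4 → 5 := by
    rintro ⟨hfin, h | h⟩
    · have ht : t.IsIncidenceLike := PointedSystem.isIncidenceLike_of_finite_twoSidedIdeal h hfin
      exact ht.projectiveHomCondition
    · have : Finite (TwoSidedIdeal Aᵐᵒᵖ) :=
        Finite.of_equiv _ TwoSidedIdeal.opOrderIso.toEquiv
      have ht : t.op.IsIncidenceLike :=
        PointedSystem.isIncidenceLike_of_finite_twoSidedIdeal h this
      exact (PointedSystem.isIncidenceLike_op.mp ht).projectiveHomCondition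
  tfae_have 5 → 1 := fun h => by
    have ht : t.IsIncidenceLike := PointedSystem.isIncidenceLike_of_projectiveHomCondition h
    exact ht.isDeformedIncidenceAlgebra
  tfae_finish
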